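/- Let $d\ge 4$ and let $L$ be the intersection lattice (up to isomorphism) of some arrangement of $d$ distinct lines in the complex projective plane $\mathbb P^2$, that is, the poset of all intersections of subfamilies of the corresponding planes through the origin in $\mathbb C^3$ (including the empty intersection $\mathbb C^3$), ordered by reverse inclusion. The multiple points $p$ of $L$ are its elements of rank $2$, and the multiplicity $m_p\ge 2$ of $p$ is the number of elements of rank $1$ (lines) below $p$. Put $$\tau(L)=\sum_p (m_p-1)^2 ,$$ where $p$ runs over the multiple points of $L$. Let $S=\mathbb C[x,y,z]$. An arrangement $\mathcal A$ of $d$ distinct lines with equations $\ell_1=0,\dots,\ell_d=0$, and $f=\ell_1\cdots\ell_d$, is called free if the graded $S$-module $$AR(f)=\{(a,b,c)\in S^3 : a f_x+b f_y+c f_z=0\}$$ is free of rank $2$, i.e. has an $S$-basis consisting of two homogeneous triples of some degrees $d_1,d_2\ge 0$. (1) If $$\tau(L)<\tfrac34(d-1)^2, \qquad (\ast)$$ then no free arrangement of $d$ distinct lines in $\mathbb P^2$ has intersection lattice isomorphic to $L$. (2) The inequality $(\ast)$ holds whenever $$\sum_p (m_p-1)>\frac{(d+3)(d-1)}4 ,$$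 where $p$ runs over the multiple points of $L$; in particular, then no free arrangement has intersection lattice isomorphic to $L$. -/

import Mathlib

open MvPolynomial
open scoped LinearAlgebra.Projectivization

noncomputable section

namespace LineArr

/-- The graded polynomial ring `S = ℂ[x, y, z]`. -/
abbrev S : Type := MvPolynomial (Fin 3) ℂ

/-- The linear form `a x + b y + c z` with coefficient vector `(a, b, c)`. -/
def linForm (a : Fin 3 → ℂ) : S := ∑ j, C (a j) * X j

/-- The zero set in `ℂ³` of the linear form with coefficient vector `a`
(the affine cone over the corresponding line of the projective plane). -/
def zeroPlane (a : Fin 3 → ℂ) : Submodule ℂ (Fin 3 → ℂ) where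
  carrier := {v | MvPolynomial.eval v (linForm a) = 0}
  zero_mem' := by simp [linForm]
  add_mem' := by
    intro v w hv hw
    simp only [linForm, Set.mem_ofPred_eq, map_sum, map_mul, eval_C, eval_X] at hv hw ⊢
    simp only [Pi.add_apply, mul_add, Finset.sum_add_distrib, hv, hw, add_zero]
  smul_mem' := by
    intro c v hv
    simp only [linForm, Set.mem_ofPred_eq, map_sum, map_mul, eval_C, eval_X] at hv ⊢
    simp only [Pi.smul_apply, smul_eq_mul, mul_left_comm _ c, ← Finset.mul_sum, hv, mul_zero]

/-- A point of `ℙ(S₁)`, i.e. a nonzero linear form up to a nonzero scalar, recorded by its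
coefficients; equivalently a line in the complex projective plane. -/
abbrev Line : Type := ℙ ℂ (Fin 3 → ℂ)

/-- `X(d)`: the ordered `d`-tuples of pairwise distinct lines. -/
def XAll (d : ℕ) : Set (Fin d → Line) := {ℓ | Function.Injective ℓ}

/-- A defining equation `f = ℓ₁ ⋯ ℓ_d` of the arrangement. It is well defined up to a nonzero
constant factor, which does not affect `AR f` below. -/
def defPoly {d : ℕ} (ℓ : Fin d → Line) : S := ∏ i, linForm (ℓ i).rep

/-- `AR(f)`: the `S`-module of Jacobian syzygies `(a, b, c) ∈ S³`, `a f_x + b f_y + c f_z = 0`. -/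
def AR (f : S) : Submodule S (Fin 3 → S) where
  carrier := {a | ∑ i, a i * pderiv i f = 0}
  zero_mem' := by simp
  add_mem' := by
    intro a b ha hb
    simp only [Set.mem_ofPred_eq] at ha hb ⊢
    simp only [Pi.add_apply, add_mul, Finset.sum_add_distrib, ha, hb, add_zero]
  smul_mem' := by
    intro c a ha
    simp only [Set.mem_ofPred_eq] at ha ⊢
    simp only [Pi.smul_apply, smul_eq_mul, mul_assoc, ← Finset.mul_sum, ha, mul_zero]

/-- The curve `f = 0` is free: the graded `S`-module `AR(f)` is free of rank two,
`AR(f) ≅ S(-d₁) ⊕ S(-d₂)`, i.e. it has an `S`-basis of two triples which are homogeneous of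
some degrees `d₁`, `d₂`. The degree `0` is allowed, so that `d` concurrent lines are free. -/
def IsFreeCurve (f : S) : Prop :=
  ∃ (e : Fin 2 → ℕ) (b : Module.Basis (Fin 2) S (AR f)),
    ∀ k i, ((b k : Fin 3 → S) i).IsHomogeneous (e k)

/-- `FX(d)`: the `d`-tuples of distinct lines forming a free arrangement. -/
def FX (d : ℕ) : Set (Fin d → Line) := {ℓ | ℓ ∈ XAll d ∧ IsFreeCurve (defPoly ℓ)}

/-- The intersection lattice `L(𝒜)`: all intersections of subfamilies of the planes in `ℂ³`
over the lines (the empty intersection is `ℂ³`), ordered by reverse inclusion. -/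
abbrev InterLattice {d : ℕ} (ℓ : Fin d → Line) : Type :=
  {W : (Submodule ℂ (Fin 3 → ℂ))ᵒᵈ //
    ∃ s : Set (Fin d), OrderDual.ofDual W = ⨅ i ∈ s, zeroPlane (ℓ i).rep}

/-- `X(L)`: the `d`-tuples of distinct lines whose intersection lattice is isomorphic to `L`. -/
def XOf (d : ℕ) (L : Type*) [PartialOrder L] : Set (Fin d → Line) :=
  {ℓ | ℓ ∈ XAll d ∧ Nonempty (InterLattice ℓ ≃o L)}

/-- `L ∈ ℒ(d)`: `L` is (isomorphic to) the intersection lattice of some arrangement of `d`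
distinct lines. -/
def IsLatticeOfLines (d : ℕ) (L : Type*) [PartialOrder L] : Prop :=
  ∃ ℓ : Fin d → Line, ℓ ∈ XAll d ∧ Nonempty (InterLattice ℓ ≃o L)

/-- The multiple points of `L`: the elements of rank two. -/
def multiplePoints (L : Type*) [PartialOrder L] : Set L := {p | Order.height p = 2}

/-- The multiplicity `m_p`: the number of lines (elements of rank one) through `p`. -/
def mult {L : Type*} [PartialOrder L] (p : L) : ℕ :=
  {a : L | Order.height a = 1 ∧ a ≤ p}.ncard

/-- `τ(L) = ∑_p (m_p - 1)²`, a finite sum for `L ∈ ℒ(d)`. -/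
def tau (L : Type*) [PartialOrder L] : ℤ :=
  ∑ᶠ p ∈ multiplePoints L, ((mult p : ℤ) - 1) ^ 2

/-- `∑_p (m_p - 1)`, a finite sum for `L ∈ ℒ(d)`. -/
def sumMult (L : Type*) [PartialOrder L] : ℤ :=
  ∑ᶠ p ∈ multiplePoints L, ((mult p : ℤ) - 1)

end LineArr

end

noncomputable section

namespace LineArr


/-! Each pair of lines meets in exactly one multiple point, so the sum of m_p(m_p-1) is d(d-1), that
is, τ + Σ(m_p-1) = d(d-1). Hence (∗) is equivalent to Σ(m_p-1) > (d+3)(d-1)/4, which gives (2). For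
(1) it remains to show 4 Σ(m_p-1) ≤ (d-1)(d+3) for a free arrangement (`four_mul_sumMult_le`). Both
sums depend only on the lattice.

The bound comes from the dimension, for large k, of the space `logDer` of derivations with
coefficients of degree k tangent to all lines. Imposing tangency to one line costs at most k+1
conditions, which bounds the dimension from below. Conversely, when line j is added to a set s of
lines, restricting θ(α_j) to line j has an image of dimension at least k+1-|s|+r, where r is the
number of points in which s meets line j (`le_finrank_of_cofactors_mul_mem`). Over all steps the
terms |s| add up to C(d,2) and the terms r to Σ(m_p-1), which gives an upper bound
(`IsFrame.finrank_logDer_upper`).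

A tangent derivation splits into a Jacobian syzygy and a multiple of the Euler derivation, so
freeness with exponents e₀, e₁ gives the dimension exactly. Comparing the linear terms in k gives d
= e₀+e₁+1; the constant terms give Σ(m_p-1) ≤ e₀e₁+d-1, and 4e₀e₁ ≤ (e₀+e₁)² = (d-1)². -/

/-! ### Cofactors of a product of polynomials in one variable -/

open Polynomial in
/-- If `p i` (`i ∈ t`) are pairwise coprime irreducible factors of `∏ i ∈ s, p i`, the cofactors
`∏ j ∈ s \ {i}, p j` with `i ∈ t` generate a space of large dimension. -/
theorem le_finrank_of_cofactors_mul_mem {K ι : Type*} [Field K] [DecidableEq ι] (s t : Finset ι)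
    (hts : t ⊆ s) (ht : t.Nonempty) (p : ι → K[X]) (hp : ∀ i ∈ s, Irreducible (p i))
    (hcop : ∀ i ∈ t, ∀ j ∈ t, i ≠ j → IsCoprime (p i) (p j))
    (n : ℕ) (W : Submodule K K[X]) [FiniteDimensional K W]
    (hW : ∀ i ∈ t, ∀ q ∈ degreeLT K (n + 1), q * ∏ j ∈ s.erase i, p j ∈ W) :
    n + t.card ≤ Module.finrank K W := by
  obtain ⟨i₀, hi₀⟩ := ht
  have hP0 : ∏ j ∈ s, p j ≠ 0 := Finset.prod_ne_zero_iff.2 fun i hi => (hp i hi).ne_zero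
  have hcof : ∀ i ∈ s, p i * ∏ j ∈ s.erase i, p j = ∏ j ∈ s, p j := fun i hi =>
    Finset.mul_prod_erase s p hi
  -- Polynomial multiples are allowed for the cofactor of i₀ only, constant multiples for the
  -- others: the source has dimension (n+1) + (|t|-1).
  let T : degreeLT K (n + 1) × ({i // i ∈ t.erase i₀} → K) →ₗ[K] K[X] :=
    LinearMap.coprod
      ((LinearMap.mulRight K (∏ j ∈ s.erase i₀, p j)).comp (degreeLT K (n + 1)).subtype)
      (∑ i : {i // i ∈ t.erase i₀}, (LinearMap.mulRight K (∏ j ∈ s.erase i.1, p j)).comp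
        ((Algebra.linearMap K K[X]).comp (LinearMap.proj i)))
  have hT : ∀ x, T x = x.1.1 * ∏ j ∈ s.erase i₀, p j +
      ∑ i : {i // i ∈ t.erase i₀}, Polynomial.C (x.2 i) * ∏ j ∈ s.erase i.1, p j := by
    intro x
    simp [T, LinearMap.sum_apply, Polynomial.algebraMap_eq]
  have hTW : ∀ x, T x ∈ W := by
    intro x
    rw [hT]
    refine W.add_mem (hW i₀ hi₀ _ x.1.2) (W.sum_mem fun i _ => hW _ (Finset.mem_of_mem_erase i.2) _ ?_)
    rw [mem_degreeLT]
    exact lt_of_le_of_lt degree_C_le (WithBot.coe_lt_coe.2 (Nat.succ_pos n))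
  have hinj : Function.Injective T := by
    rw [← LinearMap.ker_eq_bot, LinearMap.ker_eq_bot']
    intro x hx
    rw [hT] at hx
    have hc : ∀ i, x.2 i = 0 := by
      intro i
      by_contra hne
      have hit : i.1 ∈ t := Finset.mem_of_mem_erase i.2
      have his := hts hit
      -- With r the exact order of `p i` in the full product, `p i ^ r` divides the cofactors of all
      -- other members of t. A nonzero coefficient would make it divide the cofactor of i too,
      -- forcing order r+1.
      obtain ⟨r, c, hrc, hndvd⟩ : ∃ r c, ∏ j ∈ s, p j = p i.1 ^ r * c ∧ ¬ p i.1 ∣ c := by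
        have hfin : FiniteMultiplicity (p i.1) (∏ j ∈ s, p j) :=
          FiniteMultiplicity.of_not_isUnit (hp _ his).not_isUnit hP0
        obtain ⟨c, hc, hd⟩ := hfin.exists_eq_pow_mul_and_not_dvd
        exact ⟨_, c, hc, hd⟩
      have hother : ∀ j ∈ t, j ≠ i.1 → p i.1 ^ r ∣ ∏ l ∈ s.erase j, p l := by
        intro j hj hji
        have h1 : p i.1 ^ r ∣ p j * ∏ l ∈ s.erase j, p l := by
          rw [hcof j (hts hj), hrc]; exact dvd_mul_right _ _
        exact ((hcop i.1 hit j hj (Ne.symm hji)).pow_left).dvd_of_dvd_mul_left h1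
      have hd : p i.1 ^ r ∣ Polynomial.C (x.2 i) * ∏ l ∈ s.erase i.1, p l := by
        rw [← Finset.add_sum_erase _ _ (Finset.mem_univ i), ← add_assoc,
          add_right_comm] at hx
        rw [eq_neg_of_add_eq_zero_right hx, dvd_neg]
        refine dvd_add (Dvd.dvd.mul_left (hother i₀ hi₀ ?_) _) (Finset.dvd_sum fun j hj =>
          Dvd.dvd.mul_left (hother _ (Finset.mem_of_mem_erase j.2) ?_) _)
        · exact (Finset.ne_of_mem_erase i.2).symm
        · exact fun h => Finset.ne_of_mem_erase hj (Subtype.ext h)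
      have hu : IsUnit (Polynomial.C (x.2 i)) := isUnit_C.2 (isUnit_iff_ne_zero.2 hne)
      rw [hu.dvd_mul_left] at hd
      have h2 : p i.1 * p i.1 ^ r ∣ p i.1 ^ r * c := by
        rw [← hrc, ← hcof i.1 his]
        exact mul_dvd_mul_left _ hd
      rw [mul_comm] at h2
      exact hndvd ((mul_dvd_mul_iff_left (pow_ne_zero _ (hp _ his).ne_zero)).1 h2)
    have h2 : x.2 = 0 := funext hc
    have h1 : x.1.1 = 0 := by
      simp only [hc, Polynomial.C_0, zero_mul, Finset.sum_const_zero, add_zero] at hx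
      refine (mul_eq_zero.1 hx).resolve_right fun h => hP0 ?_
      rw [← hcof i₀ (hts hi₀), h, mul_zero]
    exact Prod.ext (Subtype.ext h1) h2
  have := LinearMap.finrank_le_finrank_of_injective (f := T.codRestrict W hTW)
    (fun x y h => hinj (congrArg Subtype.val h))
  have hfd : FiniteDimensional K (degreeLT K (n + 1)) := Module.Finite.equiv (degreeLTEquiv K (n + 1)).symm
  rw [Module.finrank_prod, (degreeLTEquiv K (n + 1)).finrank_eq] at this
  simp only [Module.finrank_fintype_fun_eq_card, Fintype.card_fin, Fintype.card_coe,
    Finset.card_erase_of_mem hi₀] at this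
  have := Finset.card_pos.2 ⟨i₀, hi₀⟩
  omega

/-! ### Restriction of forms to a line -/

/-- Restriction of a polynomial to the affine line `u + T v`. -/
def res (u v : Fin 3 → ℂ) : S →ₐ[ℂ] Polynomial ℂ :=
  aeval fun m => Polynomial.C (u m) + Polynomial.C (v m) * Polynomial.X

theorem res_linForm (u v a : Fin 3 → ℂ) :
    res u v (linForm a) = Polynomial.C (a ⬝ᵥ u) + Polynomial.C (a ⬝ᵥ v) * Polynomial.X := by
  simp only [linForm, res, map_sum, map_mul, aeval_X, MvPolynomial.algHom_C,
    Polynomial.algebraMap_eq, dotProduct, mul_add, Finset.sum_add_distrib, Finset.sum_mul, mul_assoc]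

theorem isHomogeneous_linForm (a : Fin 3 → ℂ) : (linForm a).IsHomogeneous 1 :=
  IsHomogeneous.sum _ _ _ fun j _ => isHomogeneous_C_mul_X (a j) j

theorem eval_linForm (a w : Fin 3 → ℂ) : MvPolynomial.eval w (linForm a) = a ⬝ᵥ w := by
  simp [linForm, dotProduct]

theorem res_X (u v : Fin 3 → ℂ) (m : Fin 3) :
    res u v (X m) = Polynomial.C (u m) + Polynomial.C (v m) * Polynomial.X := by
  simp [res]

theorem eval_res (u v : Fin 3 → ℂ) (t : ℂ) (p : S) :
    (res u v p).eval t = MvPolynomial.eval (u + t • v) p := by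
  have : (Polynomial.aeval t).comp (res u v) = aeval (u + t • v) := by
    ext m
    simp only [AlgHom.comp_apply, res_X, map_add, map_mul, Polynomial.aeval_C, Polynomial.aeval_X,
      aeval_X, Pi.add_apply, Pi.smul_apply, smul_eq_mul, Algebra.algebraMap_self, RingHom.id_apply]
    ring
  have h := DFunLike.congr_fun this p
  simpa [Polynomial.aeval_def, aeval_eq_eval, Polynomial.eval₂_id] using h

theorem res_mem_degreeLT (u v : Fin 3 → ℂ) {k : ℕ} {p : S} (hp : p.IsHomogeneous k) :
    res u v p ∈ Polynomial.degreeLT ℂ (k + 1) := by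
  rw [p.as_sum, map_sum]
  refine Submodule.sum_mem _ fun m hm => ?_
  rw [Polynomial.mem_degreeLT]
  refine lt_of_le_of_lt Polynomial.degree_le_natDegree (WithBot.coe_lt_coe.2 (Nat.lt_succ_of_le ?_))
  rw [res, aeval_monomial, Polynomial.algebraMap_eq]
  refine (Polynomial.natDegree_C_mul_le _ _).trans ?_
  rw [Finsupp.prod_fintype _ _ (by simp), hp.degree_eq_sum_deg_support hm,
    ← Finsupp.degree_apply, Finsupp.degree_eq_sum]
  refine (Polynomial.natDegree_prod_le _ _).trans (Finset.sum_le_sum fun i _ => ?_)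
  refine (Polynomial.natDegree_pow_le_of_le (m i)
    (Polynomial.natDegree_add_le_of_degree_le (n := 1) (by simp)
      ((Polynomial.natDegree_C_mul_le _ _).trans Polynomial.natDegree_X_le))).trans (by simp)

/-- A vector c with a·c = 1 completes u, v to a basis of ℂ³; α and β are the coefficient vectors of
the coordinates dual to u and v. -/
theorem exists_coordinates {u v a : Fin 3 → ℂ} (huv : LinearIndependent ℂ ![u, v])
    (ha : a ≠ 0) (hu : a ⬝ᵥ u = 0) (hv : a ⬝ᵥ v = 0) :
    ∃ α β c : Fin 3 → ℂ, (α ⬝ᵥ u = 1 ∧ α ⬝ᵥ v = 0 ∧ β ⬝ᵥ u = 0 ∧ β ⬝ᵥ v = 1) ∧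
      ∀ w, w = (α ⬝ᵥ w) • u + (β ⬝ᵥ w) • v + (a ⬝ᵥ w) • c := by
  obtain ⟨i, hi⟩ := Function.ne_iff.1 ha
  set c : Fin 3 → ℂ := Pi.single i (a i)⁻¹ with hc
  have hac : a ⬝ᵥ c = 1 := by simpa [hc] using mul_inv_cancel₀ hi
  have hspan : ∀ w ∈ Submodule.span ℂ (Set.range ![u, v]), a ⬝ᵥ w = 0 := by
    intro w hw
    induction hw using Submodule.span_induction with
    | mem x hx => obtain ⟨j, rfl⟩ := hx; fin_cases j <;> simp [hu, hv]
    | zero => simp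
    | add x y _ _ hx hy => simp [dotProduct_add, hx, hy]
    | smul r x _ hx => simp [dotProduct_smul, hx]
  have hli : LinearIndependent ℂ ![c, u, v] := by
    refine linearIndependent_finCons.2 ⟨huv, fun h => ?_⟩
    simpa [hac] using hspan _ h
  let B := basisOfLinearIndependentOfCardEqFinrank hli (by simp)
  have hB : ∀ j, B j = ![c, u, v] j := fun j => by simp [B]
  have hdual : ∀ (φ : Module.Dual ℂ (Fin 3 → ℂ)) w,
      (fun m => φ (Pi.single m 1)) ⬝ᵥ w = φ w := by
    intro φ w
    conv_rhs => rw [pi_eq_sum_univ' w, map_sum]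
    simp [dotProduct, mul_comm]
  have hB1 : B 1 = u := hB 1
  have hB2 : B 2 = v := hB 2
  have hB0 : B 0 = c := hB 0
  refine ⟨_, _, c, ⟨(hdual (B.coord 1) u).trans ?_, (hdual (B.coord 1) v).trans ?_,
    (hdual (B.coord 2) u).trans ?_, (hdual (B.coord 2) v).trans ?_⟩, fun w => ?_⟩
  · rw [← hB1]; simp
  · rw [← hB2]; simp
  · rw [← hB1]; simp
  · rw [← hB2]; simp
  · have hw := B.sum_repr w
    rw [Fin.sum_univ_three, hB0, hB1, hB2] at hw
    have h0 : a ⬝ᵥ w = B.repr w 0 := by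
      conv_lhs => rw [← hw]
      simp [dotProduct_add, dotProduct_smul, hac, hu, hv]
    rw [hdual, hdual, h0]
    conv_lhs => rw [← hw]
    simp only [Module.Basis.coord_apply]
    abel

/-- Homogenise q by the coordinates α and β, which restrict to 1 and T on u + T v. -/
theorem exists_isHomogeneous_res_eq {u v a : Fin 3 → ℂ} (huv : LinearIndependent ℂ ![u, v])
    (ha : a ≠ 0) (hu : a ⬝ᵥ u = 0) (hv : a ⬝ᵥ v = 0)
    {n : ℕ} {q : Polynomial ℂ} (hq : q ∈ Polynomial.degreeLT ℂ (n + 1)) :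
    ∃ p : S, p.IsHomogeneous n ∧ res u v p = q := by
  obtain ⟨α, β, c, ⟨h1, h2, h3, h4⟩, -⟩ := exists_coordinates huv ha hu hv
  refine ⟨∑ i ∈ Finset.range (n + 1), C (q.coeff i) * (linForm α ^ (n - i) * linForm β ^ i),
    IsHomogeneous.sum _ _ _ fun i hi => ?_, ?_⟩
  · refine IsHomogeneous.C_mul ?_ _
    have := ((isHomogeneous_linForm α).pow (n - i)).mul ((isHomogeneous_linForm β).pow i)
    have hi' := Finset.mem_range.1 hi
    rwa [one_mul, one_mul, Nat.sub_add_cancel (by omega)] at this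
  · rw [map_sum]
    simp only [map_mul, map_pow, res_linForm, h1, h2, h3, h4, algHom_C, Polynomial.algebraMap_eq]
    simp only [map_zero, zero_mul, add_zero, map_one, one_pow, one_mul, zero_add]
    refine (q.as_sum_range_C_mul_X_pow' ?_).symm
    by_cases h : q = 0
    · simp [h]
    · exact (Polynomial.natDegree_lt_iff_degree_lt h).2 (Polynomial.mem_degreeLT.1 hq)

theorem eval_smul_of_isHomogeneous {k : ℕ} {p : S} (hp : p.IsHomogeneous k) (r : ℂ)
    (w : Fin 3 → ℂ) : MvPolynomial.eval (r • w) p = r ^ k * MvPolynomial.eval w p := by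
  rw [eval_eq, eval_eq, Finset.mul_sum]
  refine Finset.sum_congr rfl fun m hm => ?_
  rw [hp.degree_eq_sum_deg_support hm]
  simp only [Pi.smul_apply, smul_eq_mul, mul_pow, Finset.prod_mul_distrib, Finset.prod_pow_eq_pow_sum]
  ring

/-- Modulo the form a, every vector equals its projection to the plane a = 0, so p is congruent to
its composite with that projection, and this composite vanishes. -/
theorem linForm_dvd_of_res_eq_zero {u v a : Fin 3 → ℂ} (huv : LinearIndependent ℂ ![u, v])
    (ha : a ≠ 0) (hu : a ⬝ᵥ u = 0) (hv : a ⬝ᵥ v = 0) {k : ℕ} {p : S} (hp : p.IsHomogeneous k)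
    (h : res u v p = 0) : linForm a ∣ p := by
  obtain ⟨α, β, c, ⟨h1, -, -, -⟩, hw⟩ := exists_coordinates huv ha hu hv
  let Y : Fin 3 → S := fun m => C (u m) * linForm α + C (v m) * linForm β
  have hX : ∀ m, (X m : S) = Y m + C (c m) * linForm a := by
    intro m
    refine MvPolynomial.funext fun w => ?_
    have := congrFun (hw w) m
    simp only [Y, map_add, map_mul, eval_X, eval_C, eval_linForm]
    simp only [Pi.add_apply, Pi.smul_apply, smul_eq_mul] at this
    linear_combination this
  let I : Ideal S := Ideal.span {linForm a}
  have hcomp : (Ideal.Quotient.mkₐ ℂ I).comp (aeval Y) = Ideal.Quotient.mkₐ ℂ I := by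
    ext m
    simp only [AlgHom.comp_apply, aeval_X, Ideal.Quotient.mkₐ_eq_mk]
    rw [hX m, Ideal.Quotient.eq]
    refine Ideal.mem_span_singleton.2 ⟨-C (c m), by ring⟩
  have hY : aeval Y p = 0 := by
    have hα : linForm α ≠ 0 := by
      intro h0
      have := eval_linForm α u
      rw [h0, h1] at this
      simp at this
    refine (mul_eq_zero.1 (?_ : linForm α * aeval Y p = 0)).resolve_left hα
    refine MvPolynomial.funext fun w => ?_
    rw [map_mul, eval_linForm, map_zero]
    by_cases hs : α ⬝ᵥ w = 0
    · rw [hs, zero_mul]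
    have he : MvPolynomial.eval w (aeval Y p) = MvPolynomial.eval
        ((α ⬝ᵥ w) • (u + ((β ⬝ᵥ w) / (α ⬝ᵥ w)) • v)) p := by
      rw [← aeval_eq_eval, ← aeval_eq_eval, ← AlgHom.comp_apply, comp_aeval]
      congr 2
      ext m
      rw [aeval_eq_eval]
      simp only [Y, map_add, map_mul, eval_C, eval_linForm, Pi.smul_apply,
        Pi.add_apply, smul_eq_mul]
      field_simp
    rw [he, eval_smul_of_isHomogeneous hp, ← eval_res, h]
    simp
  have := DFunLike.congr_fun hcomp p
  rw [AlgHom.comp_apply, hY, map_zero, Ideal.Quotient.mkₐ_eq_mk] at this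
  exact Ideal.mem_span_singleton.1 (Ideal.Quotient.eq_zero_iff_mem.1 this.symm)

theorem finrank_homogeneousSubmodule (k : ℕ) :
    Module.finrank ℂ (homogeneousSubmodule (Fin 3) ℂ k) = (k + 2).choose 2 := by
  have e : homogeneousSubmodule (Fin 3) ℂ k = restrictSupport ℂ {d | Finsupp.degree d = k} :=
    homogeneousSubmodule_eq_finsupp_supported _ _ _
  rw [e, Module.finrank_eq_nat_card_basis (basisRestrictSupport ℂ _)]
  have : {d : Fin 3 →₀ ℕ | Finsupp.degree d = k} =
      ((Finset.univ : Finset (Fin 3)).finsuppAntidiag k : Set (Fin 3 →₀ ℕ)) := by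
    ext d
    simp [Finset.mem_finsuppAntidiag, Finsupp.degree_eq_sum]
  rw [this, Nat.card_eq_card_toFinset]
  simp only [Finset.toFinset_coe, Finset.card_finsuppAntidiag_nat_eq_choose, Finset.card_univ, Fintype.card_fin]
  rw [show 3 + k - 1 = k + 2 by omega, Nat.choose_symm_add]

instance finite_homogeneousSubmodule (k : ℕ) :
    Module.Finite ℂ (homogeneousSubmodule (Fin 3) ℂ k) :=
  Module.Finite.of_fg (homogeneousSubmodule_fg _ _ k)


/-! ### Derivations tangent to a set of lines -/

/-- `u j, v j` is a basis of the plane `A j ⬝ᵥ w = 0` such that `v j` lies on no other plane. -/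
structure IsFrame {ι : Type*} (A u v : ι → Fin 3 → ℂ) : Prop where
  ne_zero : ∀ j, A j ≠ 0
  dot_left : ∀ j, A j ⬝ᵥ u j = 0
  dot_right : ∀ j, A j ⬝ᵥ v j = 0
  linearIndependent : ∀ j, LinearIndependent ℂ ![u j, v j]
  dot_ne_zero : ∀ i j, i ≠ j → A i ⬝ᵥ v j ≠ 0

/-- The value of the derivation `∑ θ m ∂_m` on the linear form with coefficients `a`. -/
def contract (a : Fin 3 → ℂ) : (Fin 3 → S) →ₗ[ℂ] S where
  toFun θ := ∑ m, θ m * C (a m)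
  map_add' θ η := by simp [add_mul, Finset.sum_add_distrib]
  map_smul' c θ := by simp [Finset.smul_sum]

theorem contract_apply (a : Fin 3 → ℂ) (θ : Fin 3 → S) : contract a θ = ∑ m, θ m * C (a m) := rfl

theorem contract_mul_C (a c : Fin 3 → ℂ) (g : S) :
    contract a (fun m => g * C (c m)) = g * C (a ⬝ᵥ c) := by
  simp only [contract_apply, dotProduct, map_sum, Finset.mul_sum, map_mul]
  exact Finset.sum_congr rfl fun m _ => by ring

theorem isHomogeneous_contract (a : Fin 3 → ℂ) {θ : Fin 3 → S} {k : ℕ}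
    (h : ∀ m, (θ m).IsHomogeneous k) : (contract a θ).IsHomogeneous k :=
  IsHomogeneous.sum _ _ _ fun m _ => by rw [mul_comm]; exact (h m).C_mul _

/-- Triples of homogeneous polynomials of degree `k`. -/
def homTriples (k : ℕ) : Submodule ℂ (Fin 3 → S) :=
  Submodule.pi Set.univ fun _ => homogeneousSubmodule (Fin 3) ℂ k

theorem mem_homTriples {k : ℕ} {θ : Fin 3 → S} :
    θ ∈ homTriples k ↔ ∀ m, (θ m).IsHomogeneous k := by
  simp [homTriples, Submodule.mem_pi]

/-- A triple of forms is a family of elements of the graded piece. -/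
def homTriplesEquiv (k : ℕ) :
    homTriples k ≃ₗ[ℂ] (Fin 3 → homogeneousSubmodule (Fin 3) ℂ k) where
  toFun θ m := ⟨θ.1 m, mem_homTriples.1 θ.2 m⟩
  invFun η := ⟨fun m => (η m).1, mem_homTriples.2 fun m => (η m).2⟩
  map_add' _ _ := rfl
  map_smul' _ _ := rfl

instance (k : ℕ) : Module.Finite ℂ (homTriples k) := Module.Finite.equiv (homTriplesEquiv k).symm

theorem finrank_homTriples (k : ℕ) :
    Module.finrank ℂ (homTriples k) = 3 * (k + 2).choose 2 := by
  rw [(homTriplesEquiv k).finrank_eq, Module.finrank_pi_fintype]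
  simp [finrank_homogeneousSubmodule]

variable {ι : Type*}

/-- The degree `k` part of the module of derivations tangent to the lines indexed by `s`. -/
def logDer (A u v : ι → Fin 3 → ℂ) (k : ℕ) (s : Finset ι) : Submodule ℂ (Fin 3 → S) :=
  homTriples k ⊓ ⨅ j ∈ s, LinearMap.ker ((res (u j) (v j)).toLinearMap ∘ₗ contract (A j))

theorem mem_logDer {A u v : ι → Fin 3 → ℂ} {k : ℕ} {s : Finset ι} {θ : Fin 3 → S} :
    θ ∈ logDer A u v k s ↔
      (∀ m, (θ m).IsHomogeneous k) ∧ ∀ j ∈ s, res (u j) (v j) (contract (A j) θ) = 0 := by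
  simp [logDer, mem_homTriples]

instance (A u v : ι → Fin 3 → ℂ) (k : ℕ) (s : Finset ι) : Module.Finite ℂ (logDer A u v k s) :=
  Submodule.finiteDimensional_of_le (inf_le_left : _ ≤ homTriples k)

theorem finrank_logDer_empty (A u v : ι → Fin 3 → ℂ) (k : ℕ) :
    Module.finrank ℂ (logDer A u v k ∅) = 3 * (k + 2).choose 2 := by
  have : logDer A u v k ∅ = homTriples k := by simp [logDer]
  rw [this, finrank_homTriples]

theorem finrank_map_add_finrank_inf_ker {K V W : Type*} [Field K] [AddCommGroup V] [Module K V]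
    [AddCommGroup W] [Module K W] (N : Submodule K V) [FiniteDimensional K N] (T : V →ₗ[K] W) :
    Module.finrank K (N.map T) + Module.finrank K (N ⊓ LinearMap.ker T : Submodule K V) =
      Module.finrank K N := by
  have h := LinearMap.finrank_range_add_finrank_ker (T.domRestrict N)
  rw [LinearMap.range_domRestrict, LinearMap.ker_domRestrict,
    ← Submodule.finrank_map_subtype_eq N, Submodule.map_comap_subtype] at h
  exact h

theorem finrank_map_add_finrank_logDer_insert [DecidableEq ι] (A u v : ι → Fin 3 → ℂ) (k : ℕ)
    (s : Finset ι) (j : ι) :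
    Module.finrank ℂ ((logDer A u v k s).map
        ((res (u j) (v j)).toLinearMap ∘ₗ contract (A j))) +
      Module.finrank ℂ (logDer A u v k (insert j s)) = Module.finrank ℂ (logDer A u v k s) := by
  rw [← finrank_map_add_finrank_inf_ker (logDer A u v k s)
    ((res (u j) (v j)).toLinearMap ∘ₗ contract (A j)), logDer, logDer, Finset.iInf_insert,
    inf_assoc, inf_comm (LinearMap.ker _)]

theorem map_logDer_le (A u v : ι → Fin 3 → ℂ) (k : ℕ) (s : Finset ι) (j : ι) :
    (logDer A u v k s).map ((res (u j) (v j)).toLinearMap ∘ₗ contract (A j)) ≤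
      Polynomial.degreeLT ℂ (k + 1) := by
  rintro _ ⟨θ, hθ, rfl⟩
  exact res_mem_degreeLT _ _ (isHomogeneous_contract _ (mem_logDer.1 hθ).1)

theorem finrank_degreeLT (n : ℕ) : Module.finrank ℂ (Polynomial.degreeLT ℂ n) = n := by
  rw [(Polynomial.degreeLTEquiv ℂ n).finrank_eq]
  simp

instance (n : ℕ) : Module.Finite ℂ (Polynomial.degreeLT ℂ n) :=
  Module.Finite.equiv (Polynomial.degreeLTEquiv ℂ n).symm

theorem finrank_logDer_le_insert [DecidableEq ι] (A u v : ι → Fin 3 → ℂ) (k : ℕ) (s : Finset ι)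
    (j : ι) :
    Module.finrank ℂ (logDer A u v k s) ≤
      Module.finrank ℂ (logDer A u v k (insert j s)) + (k + 1) := by
  have h := finrank_map_add_finrank_logDer_insert A u v k s j
  have h2 := Submodule.finrank_mono (map_logDer_le A u v k s j)
  rw [finrank_degreeLT] at h2
  omega

/-- Since `v j` lies on no other plane, no intersection point with line j is at infinity, and the
restricted form has degree exactly one. -/
theorem IsFrame.irreducible_res {A u v : ι → Fin 3 → ℂ} (hF : IsFrame A u v) {i j : ι}
    (hij : i ≠ j) : Irreducible (res (u j) (v j) (linForm (A i))) := by
  refine Polynomial.irreducible_of_degree_eq_one ?_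
  rw [res_linForm, add_comm]
  exact Polynomial.degree_linear (hF.dot_ne_zero i j hij)

theorem IsFrame.res_self {A u v : ι → Fin 3 → ℂ} (hF : IsFrame A u v) (j : ι) :
    res (u j) (v j) (linForm (A j)) = 0 := by
  simp [res_linForm, hF.dot_left, hF.dot_right]

/-- The lines in `t` meet the line `j` in distinct points, and every such point makes the
restriction of `logDer` to the line `j` larger. -/
theorem IsFrame.finrank_logDer_insert_add_le [DecidableEq ι] {A u v : ι → Fin 3 → ℂ}
    (hF : IsFrame A u v) {k : ℕ} {s t : Finset ι} {j : ι} (hj : j ∉ s) (hts : t ⊆ s)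
    (ht : s.Nonempty → t.Nonempty) (hk : s.card ≤ k)
    (hcop : ∀ i ∈ t, ∀ l ∈ t, i ≠ l →
      IsCoprime (res (u j) (v j) (linForm (A i))) (res (u j) (v j) (linForm (A l)))) :
    Module.finrank ℂ (logDer A u v k (insert j s)) + (k + 1) + t.card ≤
      Module.finrank ℂ (logDer A u v k s) + s.card := by
  rw [← finrank_map_add_finrank_logDer_insert A u v k s j]
  have hne : ∀ i ∈ s, i ≠ j := fun i hi h => hj (h ▸ hi)
  rcases s.eq_empty_or_nonempty with rfl | hs
  -- With no tangency conditions the restriction is onto: p times a constant field c with A_j·c = 1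
  -- restricts to any prescribed polynomial.
  · have : Polynomial.degreeLT ℂ (k + 1) ≤ (logDer A u v k ∅).map
        ((res (u j) (v j)).toLinearMap ∘ₗ contract (A j)) := by
      intro q hq
      obtain ⟨p, hp, rfl⟩ := exists_isHomogeneous_res_eq (hF.linearIndependent j) (hF.ne_zero j)
        (hF.dot_left j) (hF.dot_right j) hq
      obtain ⟨i, hi⟩ := Function.ne_iff.1 (hF.ne_zero j)
      refine ⟨fun m => p * C (Pi.single (M := fun _ => ℂ) i (A j i)⁻¹ m), mem_logDer.2
        ⟨fun m => by rw [mul_comm]; exact hp.C_mul _, by simp⟩, ?_⟩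
      have h1 : A j i * (A j i)⁻¹ = 1 := mul_inv_cancel₀ hi
      simp [contract_mul_C, h1]
    have := Submodule.finrank_mono this
    rw [finrank_degreeLT] at this
    rw [Finset.subset_empty.1 hts, Finset.card_empty]
    omega
  · have hfd : FiniteDimensional ℂ ((logDer A u v k s).map
        ((res (u j) (v j)).toLinearMap ∘ₗ contract (A j))) := inferInstance
    have hc := hs.card_pos
    -- A cofactor uses |s|-1 linear factors, which leaves degree k+1-|s| for the free multiplier.
    have := le_finrank_of_cofactors_mul_mem s t hts (ht hs)
      (fun i => res (u j) (v j) (linForm (A i))) (fun i hi => hF.irreducible_res (hne i hi)) hcop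
      (k + 1 - s.card) ((logDer A u v k s).map
        ((res (u j) (v j)).toLinearMap ∘ₗ contract (A j))) (fun i hi q hq => ?_)
    · omega
    obtain ⟨p, hp, rfl⟩ := exists_isHomogeneous_res_eq (hF.linearIndependent j) (hF.ne_zero j)
      (hF.dot_left j) (hF.dot_right j) hq
    have hij := hne i (hts hi)
    have hAv : A j ⬝ᵥ v i ≠ 0 := hF.dot_ne_zero j i hij.symm
    -- The constant direction `v i` is tangent to line i and the product vanishes on the other lines
    -- of s. Dividing by A_j·v_i makes the value on the form of line j exactly p times the cofactor.
    refine ⟨fun m => (p * ∏ l ∈ s.erase i, linForm (A l)) * C (((A j ⬝ᵥ v i)⁻¹ • v i) m),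
      mem_logDer.2 ⟨fun m => ?_, fun l hl => ?_⟩, ?_⟩
    · rw [mul_comm]
      refine IsHomogeneous.C_mul ?_ _
      have := hp.mul (IsHomogeneous.prod (s.erase i) (fun l => linForm (A l)) (fun _ => 1)
        fun l _ => isHomogeneous_linForm (A l))
      rw [Finset.sum_const, Finset.card_erase_of_mem (hts hi), smul_eq_mul, mul_one] at this
      convert this using 1
      omega
    · rw [contract_mul_C]
      by_cases hli : l = i
      · simp [hli, hF.dot_right]
      · have : res (u l) (v l) (∏ l ∈ s.erase i, linForm (A l)) = 0 := by
          rw [map_prod]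
          exact Finset.prod_eq_zero (Finset.mem_erase.2 ⟨hli, hl⟩) (hF.res_self l)
        rw [map_mul, map_mul, this, mul_zero, zero_mul]
    · simp only [LinearMap.comp_apply, AlgHom.toLinearMap_apply]
      rw [contract_mul_C, dotProduct_smul, smul_eq_mul, inv_mul_cancel₀ hAv]
      simp [map_prod]


/-! ### Jacobian syzygies and the Euler derivation -/

theorem homogeneousComponent_mul_of_isHomogeneous {m n : ℕ} {g : S} (hg : g.IsHomogeneous m)
    (h : S) (hmn : m ≤ n) :
    homogeneousComponent n (h * g) = homogeneousComponent (n - m) h * g := by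
  let _ : GradedAlgebra (homogeneousSubmodule (Fin 3) ℂ) := MvPolynomial.gradedAlgebra
  have := DirectSum.coe_decompose_mul_of_right_mem (homogeneousSubmodule (Fin 3) ℂ) (a := h) n
    ((mem_homogeneousSubmodule m g).2 hg)
  rw [if_pos hmn] at this
  have e : ∀ (p : S) (i : ℕ), ((DirectSum.decompose (homogeneousSubmodule (Fin 3) ℂ) p) i : S) =
      homogeneousComponent i p := fun p i => decomposition.decompose'_apply p i
  rwa [e, e] at this

theorem pderiv_linForm (a : Fin 3 → ℂ) (m : Fin 3) : pderiv m (linForm a) = C (a m) := by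
  simp [linForm, pderiv_X, Pi.single_apply]

/-- The Leibniz rule. On line j only the summand i = j survives, which links syzygies to tangency.
-/
theorem sum_mul_pderiv_prod_linForm {ι : Type*} [DecidableEq ι] (A : ι → Fin 3 → ℂ)
    (s : Finset ι) (θ : Fin 3 → S) :
    ∑ m, θ m * pderiv m (∏ i ∈ s, linForm (A i)) =
      ∑ i ∈ s, contract (A i) θ * ∏ l ∈ s.erase i, linForm (A l) := by
  induction s using Finset.induction_on with
  | empty => simp
  | insert j s hj ih =>
    rw [Finset.sum_insert hj, Finset.erase_insert hj, Finset.prod_insert hj]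
    have h1 : ∀ i ∈ s, contract (A i) θ * ∏ l ∈ (insert j s).erase i, linForm (A l) =
        linForm (A j) * (contract (A i) θ * ∏ l ∈ s.erase i, linForm (A l)) := by
      intro i hi
      have hij : i ≠ j := fun h => hj (h ▸ hi)
      rw [Finset.erase_insert_of_ne hij.symm, Finset.prod_insert (by simp [hj])]
      ring
    rw [Finset.sum_congr rfl h1, ← Finset.mul_sum, ← ih, contract_apply, Finset.sum_mul,
      Finset.mul_sum, ← Finset.sum_add_distrib]
    refine Finset.sum_congr rfl fun m _ => ?_
    rw [Derivation.leibniz, pderiv_linForm, smul_eq_mul, smul_eq_mul]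
    ring

theorem contract_X (a : Fin 3 → ℂ) (h : S) : contract a (fun m => h * X m) = h * linForm a := by
  simp only [contract_apply, linForm, Finset.mul_sum]
  exact Finset.sum_congr rfl fun m _ => by ring

/-- The degree `k` part of `AR f`. -/
def arHom (f : S) (k : ℕ) : Submodule ℂ (Fin 3 → S) :=
  homTriples k ⊓ (AR f).restrictScalars ℂ

theorem mem_arHom {f : S} {k : ℕ} {θ : Fin 3 → S} :
    θ ∈ arHom f k ↔ (∀ m, (θ m).IsHomogeneous k) ∧ ∑ m, θ m * pderiv m f = 0 := by
  simp only [arHom, Submodule.mem_inf, mem_homTriples, Submodule.restrictScalars_mem]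
  rfl

instance (f : S) (k : ℕ) : Module.Finite ℂ (arHom f k) :=
  Submodule.finiteDimensional_of_le (inf_le_left : _ ≤ homTriples k)

theorem isHomogeneous_prod_linForm {ι : Type*} (A : ι → Fin 3 → ℂ) (s : Finset ι) :
    (∏ i ∈ s, linForm (A i)).IsHomogeneous s.card := by
  have := IsHomogeneous.prod s (fun l => linForm (A l)) (fun _ => 1)
        fun l _ => isHomogeneous_linForm (A l)
  rwa [Finset.sum_const, smul_eq_mul, mul_one] at this

theorem linForm_ne_zero {a : Fin 3 → ℂ} (ha : a ≠ 0) : linForm a ≠ 0 := by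
  intro h
  refine ha (funext fun m => ?_)
  have := pderiv_linForm a m
  rw [h, map_zero] at this
  simpa using this.symm

/-- A derivation tangent to all lines splits into a syzygy and a multiple of the Euler
derivation. -/
theorem IsFrame.finrank_logDer_univ {ι : Type*} [Fintype ι] [DecidableEq ι] [Nonempty ι]
    {A u v : ι → Fin 3 → ℂ} (hF : IsFrame A u v) (n : ℕ) :
    Module.finrank ℂ (logDer A u v (n + 1) Finset.univ) =
      Module.finrank ℂ (arHom (∏ i, linForm (A i)) (n + 1)) + (n + 2).choose 2 := by
  set f := ∏ i, linForm (A i) with hf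
  set d := Fintype.card ι with hd
  have hd0 : (d : ℂ) ≠ 0 := by exact_mod_cast Fintype.card_ne_zero
  have hf0 : f ≠ 0 := Finset.prod_ne_zero_iff.2 fun i _ => linForm_ne_zero (hF.ne_zero i)
  have hfh : f.IsHomogeneous d := isHomogeneous_prod_linForm A Finset.univ
  have heul : ∀ h : S, ∑ m, h * X m * pderiv m f = h * (C (d : ℂ) * f) := by
    intro h
    have := hfh.sum_X_mul_pderiv
    rw [nsmul_eq_mul, show ((d : ℕ) : S) = C (d : ℂ) by simp] at this
    rw [← this, Finset.mul_sum]
    exact Finset.sum_congr rfl fun m _ => mul_assoc _ _ _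
  let Φ : arHom f (n + 1) × homogeneousSubmodule (Fin 3) ℂ n →ₗ[ℂ] (Fin 3 → S) :=
    LinearMap.coprod (arHom f (n + 1)).subtype
      ((LinearMap.pi fun m => LinearMap.mulRight ℂ (X m : S)).comp
        (homogeneousSubmodule (Fin 3) ℂ n).subtype)
  have hΦ : ∀ x, Φ x = x.1.1 + fun m => x.2.1 * X m := fun x => rfl
  have hinj : Function.Injective Φ := by
    rw [← LinearMap.ker_eq_bot, LinearMap.ker_eq_bot']
    rintro ⟨⟨θ, hθ⟩, ⟨h, hh⟩⟩ hx
    rw [hΦ] at hx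
    simp only at hx
    have h1 : ∑ m, (θ + fun m => h * X m : Fin 3 → S) m * pderiv m f = 0 := by rw [hx]; simp
    simp only [Pi.add_apply, add_mul, Finset.sum_add_distrib, heul, (mem_arHom.1 hθ).2,
      zero_add] at h1
    have h2 : h = 0 := by
      refine (mul_eq_zero.1 h1).resolve_right (mul_ne_zero ?_ hf0)
      exact fun h0 => hd0 (C_injective (Fin 3) ℂ (by simpa using h0))
    subst h2
    have h3 : θ = 0 := by
      rw [← hx]; ext1 m; simp
    subst h3
    rfl
  have hrange : LinearMap.range Φ = logDer A u v (n + 1) Finset.univ := by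
    apply le_antisymm
    · rintro _ ⟨⟨⟨θ, hθ⟩, ⟨h, hh⟩⟩, rfl⟩
      rw [hΦ]
      refine Submodule.add_mem _ ?_ ?_
      · refine mem_logDer.2 ⟨(mem_arHom.1 hθ).1, fun j _ => ?_⟩
        have h1 := (mem_arHom.1 hθ).2
        rw [hf, sum_mul_pderiv_prod_linForm] at h1
        have h2 := congrArg (res (u j) (v j)) h1
        -- The cofactor of j is nonzero on line j, so the first factor must vanish there.
        rw [map_sum, map_zero, Finset.sum_eq_single j] at h2
        · rw [map_mul] at h2
          refine (mul_eq_zero.1 h2).resolve_right ?_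
          rw [map_prod]
          exact Finset.prod_ne_zero_iff.2 fun i hi =>
            (hF.irreducible_res (Finset.ne_of_mem_erase hi)).ne_zero
        · intro i _ hij
          have : res (u j) (v j) (∏ l ∈ Finset.univ.erase i, linForm (A l)) = 0 := by
            rw [map_prod]
            exact Finset.prod_eq_zero (Finset.mem_erase.2 ⟨hij.symm, Finset.mem_univ j⟩)
              (hF.res_self j)
          rw [map_mul, this, mul_zero]
        · simp
      · refine mem_logDer.2 ⟨fun m => ((mem_homogeneousSubmodule _ _).1 hh).mul
          (isHomogeneous_X ℂ m), fun j _ => ?_⟩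
        simp only
        rw [contract_X, map_mul, hF.res_self, mul_zero]
    · intro θ hθ
      obtain ⟨hθh, hθ⟩ := mem_logDer.1 hθ
      have hdvd : f ∣ ∑ m, θ m * pderiv m f := by
        rw [hf, sum_mul_pderiv_prod_linForm]
        refine Finset.dvd_sum fun i hi => ?_
        rw [← Finset.mul_prod_erase _ _ hi]
        exact mul_dvd_mul_right (linForm_dvd_of_res_eq_zero (hF.linearIndependent i) (hF.ne_zero i)
          (hF.dot_left i) (hF.dot_right i) (isHomogeneous_contract _ hθh) (hθ i hi)) _
      obtain ⟨h, hh⟩ := hdvd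
      have hd1 : 1 ≤ d := Fintype.card_pos
      have hhom : (∑ m, θ m * pderiv m f).IsHomogeneous (n + d) :=
        IsHomogeneous.sum _ _ _ fun m _ => by
          have := (hθh m).mul (hfh.pderiv (i := m))
          convert this using 1
          omega
      -- The quotient of θ(f) by f may be replaced by its component of degree n. Since the Euler
      -- derivation sends f to d·f, subtracting 1/d times this component leaves a syzygy.
      have hh' : ∑ m, θ m * pderiv m f = homogeneousComponent n h * f := by
        rw [← homogeneousComponent_eq_self hhom, hh, mul_comm,
          homogeneousComponent_mul_of_isHomogeneous hfh h (Nat.le_add_left d n),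
          Nat.add_sub_cancel]
      set g : S := C ((d : ℂ)⁻¹) * homogeneousComponent n h with hg
      have hgh : g.IsHomogeneous n := (homogeneousComponent_isHomogeneous n h).C_mul _
      refine ⟨⟨⟨θ - fun m => g * X m, mem_arHom.2 ⟨fun m => ?_, ?_⟩⟩, ⟨g, hgh⟩⟩, ?_⟩
      · exact (hθh m).sub (hgh.mul (isHomogeneous_X ℂ m))
      · simp only [Pi.sub_apply, sub_mul, Finset.sum_sub_distrib, heul, hh', hg]
        have : (C ((d : ℂ)⁻¹) * C (d : ℂ) : S) = 1 := by
          rw [← C_mul, inv_mul_cancel₀ hd0, C_1]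
        linear_combination (- homogeneousComponent n h * f) * this
      · rw [hΦ]; simp
  rw [← hrange, LinearMap.finrank_range_of_inj hinj, Module.finrank_prod,
    finrank_homogeneousSubmodule]

/-- As the basis is homogeneous, the coordinates of a syzygy of degree k can be replaced by their
components of degrees k - e₀ and k - e₁. -/
theorem finrank_arHom_of_basis {f : S} (e : Fin 2 → ℕ) (b : Module.Basis (Fin 2) S (AR f))
    (hb : ∀ k i, ((b k : Fin 3 → S) i).IsHomogeneous (e k)) {k : ℕ} (h0 : e 0 ≤ k) (h1 : e 1 ≤ k) :
    Module.finrank ℂ (arHom f k) = (k - e 0 + 2).choose 2 + (k - e 1 + 2).choose 2 := by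
  let Ψ : homogeneousSubmodule (Fin 3) ℂ (k - e 0) × homogeneousSubmodule (Fin 3) ℂ (k - e 1)
      →ₗ[ℂ] (Fin 3 → S) :=
    LinearMap.coprod
      ((LinearMap.pi fun m => LinearMap.mulRight ℂ ((b 0 : Fin 3 → S) m)).comp
        (Submodule.subtype _))
      ((LinearMap.pi fun m => LinearMap.mulRight ℂ ((b 1 : Fin 3 → S) m)).comp
        (Submodule.subtype _))
  have hΨ : ∀ x, Ψ x = ((x.1.1 • b 0 + x.2.1 • b 1 : AR f) : Fin 3 → S) := fun x => rfl
  have hinj : Function.Injective Ψ := by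
    rw [← LinearMap.ker_eq_bot, LinearMap.ker_eq_bot']
    rintro ⟨⟨p, hp⟩, ⟨q, hq⟩⟩ hx
    rw [hΨ] at hx
    have h := Fintype.linearIndependent_iff.1 b.linearIndependent ![p, q]
      (by rw [Fin.sum_univ_two]; exact Subtype.ext hx)
    have hp0 : p = 0 := h 0
    have hq0 : q = 0 := h 1
    subst hp0 hq0
    rfl
  have hrange : LinearMap.range Ψ = arHom f k := by
    apply le_antisymm
    · rintro _ ⟨⟨⟨p, hp⟩, ⟨q, hq⟩⟩, rfl⟩
      refine mem_arHom.2 ⟨fun m => ?_, ?_⟩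
      · rw [hΨ]
        have hp' := ((mem_homogeneousSubmodule _ _).1 hp).mul (hb 0 m)
        have hq' := ((mem_homogeneousSubmodule _ _).1 hq).mul (hb 1 m)
        rw [Nat.sub_add_cancel h0] at hp'
        rw [Nat.sub_add_cancel h1] at hq'
        exact hp'.add hq'
      · rw [hΨ]
        exact (p • b 0 + q • b 1 : AR f).2
    · intro θ hθ
      obtain ⟨hθh, hθ0⟩ := mem_arHom.1 hθ
      let η : AR f := ⟨θ, hθ0⟩
      have hη := b.sum_repr η
      rw [Fin.sum_univ_two] at hη
      refine ⟨⟨⟨homogeneousComponent (k - e 0) (b.repr η 0), homogeneousComponent_mem _ _⟩,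
        ⟨homogeneousComponent (k - e 1) (b.repr η 1), homogeneousComponent_mem _ _⟩⟩, ?_⟩
      funext m
      have hm : b.repr η 0 * (b 0 : Fin 3 → S) m + b.repr η 1 * (b 1 : Fin 3 → S) m = θ m :=
        congrFun (congrArg Subtype.val hη) m
      rw [← homogeneousComponent_eq_self (hθh m), ← hm, map_add,
        homogeneousComponent_mul_of_isHomogeneous (hb 0 m) _ h0,
        homogeneousComponent_mul_of_isHomogeneous (hb 1 m) _ h1]
      rfl
  rw [← hrange, LinearMap.finrank_range_of_inj hinj, Module.finrank_prod,
    finrank_homogeneousSubmodule, finrank_homogeneousSubmodule]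


/-! ### Two bounds for the Hilbert function and their comparison -/

/-- Each line imposes at most k+1 linear conditions, the dimension of the polynomials of degree at
most k on it. -/
theorem finrank_logDer_lower {ι : Type*} [DecidableEq ι] (A u v : ι → Fin 3 → ℂ) (k : ℕ)
    (s : Finset ι) :
    3 * (k + 2).choose 2 ≤ Module.finrank ℂ (logDer A u v k s) + s.card * (k + 1) := by
  induction s using Finset.induction_on with
  | empty => rw [finrank_logDer_empty]; omega
  | insert j s hj ih =>
    have := finrank_logDer_le_insert A u v k s j
    rw [Finset.card_insert_of_notMem hj, add_mul]
    omega

/-- `I p` is the set of lines through the point `p`. -/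
theorem IsFrame.finrank_logDer_upper {ι Q : Type*} [DecidableEq ι] [Fintype Q]
    {A u v : ι → Fin 3 → ℂ} (hF : IsFrame A u v) (I : Q → Finset ι)
    (hex : ∀ i j, i ≠ j → ∃ p, i ∈ I p ∧ j ∈ I p)
    (huniq : ∀ i j p q, i ≠ j → i ∈ I p → j ∈ I p → i ∈ I q → j ∈ I q → p = q)
    (hgeo : ∀ i l j, i ≠ j → l ≠ j →
      ¬ IsCoprime (res (u j) (v j) (linForm (A i))) (res (u j) (v j) (linForm (A l))) →
      ∃ p, i ∈ I p ∧ l ∈ I p ∧ j ∈ I p)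
    (k : ℕ) (s : Finset ι) (hk : s.card ≤ k) :
    Module.finrank ℂ (logDer A u v k s) + s.card * (k + 1) + ∑ p, ((I p ∩ s).card - 1) ≤
      3 * (k + 2).choose 2 + s.card.choose 2 := by
  classical
  induction s using Finset.induction_on with
  | empty => rw [finrank_logDer_empty]; simp
  | insert j s hj ih =>
    rw [Finset.card_insert_of_notMem hj] at hk ⊢
    have ih := ih (by omega)
    -- P consists of the points where line j meets earlier lines; g picks one earlier line through
    -- each, and these lines meet line j in distinct points.
    set P : Finset Q := Finset.univ.filter fun p => j ∈ I p ∧ (I p ∩ s).Nonempty with hP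
    have hch : ∀ p : P, ∃ i, i ∈ I p.1 ∩ s := fun p => ((Finset.mem_filter.1 p.2).2).2
    choose g hg using hch
    have hgI : ∀ p, g p ∈ I p.1 := fun p => (Finset.mem_inter.1 (hg p)).1
    have hgs : ∀ p, g p ∈ s := fun p => (Finset.mem_inter.1 (hg p)).2
    have hgj : ∀ p, g p ≠ j := fun p h => hj (h ▸ hgs p)
    have hjI : ∀ p : P, j ∈ I p.1 := fun p => ((Finset.mem_filter.1 p.2).2).1
    have hginj : Function.Injective g := by
      intro p q hpq
      exact Subtype.ext (huniq (g p) j _ _ (hgj p) (hgI p) (hjI p) (hpq ▸ hgI q) (hjI q))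
    -- Adding j raises a summand by one exactly at the points of P. At a point of j on no earlier
    -- line, the truncated value is 0 both before and after.
    have hσ : ∑ p, ((I p ∩ insert j s).card - 1) = ∑ p, ((I p ∩ s).card - 1) + P.card := by
      rw [hP, Finset.card_filter, ← Finset.sum_add_distrib]
      refine Finset.sum_congr rfl fun p _ => ?_
      by_cases hjp : j ∈ I p
      · rw [Finset.inter_insert_of_mem hjp, Finset.card_insert_of_notMem (by simp [hj])]
        by_cases hne : (I p ∩ s).Nonempty
        · have := hne.card_pos
          rw [if_pos ⟨hjp, hne⟩]
          omega
        · rw [if_neg fun h => hne h.2, Finset.not_nonempty_iff_eq_empty.1 hne]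
          simp
      · rw [Finset.inter_insert_of_notMem hjp, if_neg fun h => hjp h.1]
        simp
    have h := hF.finrank_logDer_insert_add_le (k := k) (t := Finset.univ.image g) hj
      (by
        intro i hi
        obtain ⟨p, -, rfl⟩ := Finset.mem_image.1 hi
        exact hgs p)
      (by
        rintro ⟨i, hi⟩
        have hij : i ≠ j := fun h => hj (h ▸ hi)
        obtain ⟨p, hip, hjp⟩ := hex i j hij
        have hp : p ∈ P := Finset.mem_filter.2
          ⟨Finset.mem_univ p, hjp, ⟨i, Finset.mem_inter.2 ⟨hip, hi⟩⟩⟩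
        exact ⟨g ⟨p, hp⟩, Finset.mem_image_of_mem g (Finset.mem_univ _)⟩)
      (by omega)
      (by
        intro i hi l hl hil
        obtain ⟨p, -, rfl⟩ := Finset.mem_image.1 hi
        obtain ⟨q, -, rfl⟩ := Finset.mem_image.1 hl
        by_contra hcop
        obtain ⟨r, h1, h2, h3⟩ := hgeo _ _ j (hgj p) (hgj q) hcop
        have e1 := huniq _ j _ _ (hgj p) h1 h3 (hgI p) (hjI p)
        have e2 := huniq _ j _ _ (hgj q) h2 h3 (hgI q) (hjI q)
        exact hil (congrArg g (Subtype.ext (e1.symm.trans e2))))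
    rw [Finset.card_image_of_injective _ hginj, Finset.card_univ, Fintype.card_coe] at h
    have hc : (s.card + 1).choose 2 = s.card + s.card.choose 2 := by
      rw [Nat.choose_succ_succ' s.card 1, Nat.choose_one_right]
    rw [hσ, hc, add_mul]
    omega

theorem nonneg_of_forall_le {a b : ℤ} (N : ℕ) (h : ∀ n : ℕ, N ≤ n → 0 ≤ a * n + b) : 0 ≤ a := by
  by_contra ha
  have h1 := h (N + b.natAbs + 1) (by omega)
  push_cast at h1
  have h2 : b ≤ |b| := le_abs_self b
  nlinarith [abs_nonneg b]

/-- A numerical comparison of Hilbert functions. -/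
theorem four_mul_le_of_hilbert_bounds {d e₀ e₁ σ N : ℕ}
    (hle : ∀ n, N ≤ n → (n + 1 - e₀ + 2).choose 2 + (n + 1 - e₁ + 2).choose 2 + (n + 2).choose 2 +
      d * (n + 2) + σ ≤ 3 * (n + 3).choose 2 + d.choose 2)
    (hge : ∀ n, N ≤ n → 3 * (n + 3).choose 2 ≤ (n + 1 - e₀ + 2).choose 2 +
      (n + 1 - e₁ + 2).choose 2 + (n + 2).choose 2 + d * (n + 2)) :
    4 * (σ : ℤ) ≤ (d - 1) * (d + 3) := by
  have hc : ∀ m : ℕ, 2 * (m.choose 2 : ℤ) = m * (m - 1) := by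
    intro m
    have : ((m.choose 2 : ℕ) : ℚ) = m * (m - 1) / 2 := Nat.cast_choose_two ℚ m
    have h2 : (2 * (m.choose 2 : ℤ) : ℚ) = ((m * (m - 1) : ℤ) : ℚ) := by
      push_cast; rw [this]; ring
    exact_mod_cast h2
  -- Twice each bound, with quadratic terms in n cancelled. The two slopes are opposite, so both
  -- vanish.
  have key : ∀ n, N + e₀ + e₁ ≤ n →
      0 ≤ (2 * ((e₀ : ℤ) + e₁ + 1 - d)) * n + (18 + d * (d - 1) - 4 * d - 2 * σ - 2 -
        (e₀ - 3) * (e₀ - 2) - (e₁ - 3) * (e₁ - 2)) ∧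
      0 ≤ (2 * ((d : ℤ) - (e₀ + e₁ + 1))) * n - (18 - 4 * d - 2 -
        (e₀ - 3) * (e₀ - 2) - (e₁ - 3) * (e₁ - 2)) := by
    intro n hn
    have h1 := hle n (by omega)
    have h2 := hge n (by omega)
    zify at h1 h2
    have c1 := hc (n + 1 - e₀ + 2)
    have c2 := hc (n + 1 - e₁ + 2)
    have c3 := hc (n + 2)
    have c4 := hc (n + 3)
    have c5 := hc d
    push_cast [show e₀ ≤ n + 1 by omega, show e₁ ≤ n + 1 by omega] at c1 c2 c3 c4 c5
    constructor <;> nlinarith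
  have a1 := nonneg_of_forall_le (N + e₀ + e₁) fun n hn => (key n hn).1
  have a2 := nonneg_of_forall_le (N + e₀ + e₁) fun n hn => by
    have := (key n hn).2
    rwa [sub_eq_add_neg] at this
  have hd : (d : ℤ) = e₀ + e₁ + 1 := by linarith
  -- With zero slope the constant term says σ ≤ e₀e₁ + d - 1; the square (e₀-e₁)² ≥ 0 then bounds
  -- 4e₀e₁ by (d-1)².
  have := (key _ le_rfl).1
  rw [hd] at this ⊢
  nlinarith [sq_nonneg ((e₀ : ℤ) - e₁)]

theorem IsFrame.four_mul_le_of_isFreeCurve {ι Q : Type*} [Fintype ι] [Nonempty ι] [Fintype Q]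
    {A u v : ι → Fin 3 → ℂ} (hF : IsFrame A u v) (I : Q → Finset ι)
    (hex : ∀ i j, i ≠ j → ∃ p, i ∈ I p ∧ j ∈ I p)
    (huniq : ∀ i j p q, i ≠ j → i ∈ I p → j ∈ I p → i ∈ I q → j ∈ I q → p = q)
    (hgeo : ∀ i l j, i ≠ j → l ≠ j →
      ¬ IsCoprime (res (u j) (v j) (linForm (A i))) (res (u j) (v j) (linForm (A l))) →
      ∃ p, i ∈ I p ∧ l ∈ I p ∧ j ∈ I p)
    (hfree : IsFreeCurve (∏ i, linForm (A i))) :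
    4 * ((∑ p, ((I p).card - 1) : ℕ) : ℤ) ≤ (Fintype.card ι - 1) * (Fintype.card ι + 3) := by
  classical
  obtain ⟨e, b, hb⟩ := hfree
  refine four_mul_le_of_hilbert_bounds (e₀ := e 0) (e₁ := e 1)
    (N := e 0 + e 1 + Fintype.card ι) (fun n hn => ?_) (fun n hn => ?_)
  · have h1 := hF.finrank_logDer_upper I hex huniq hgeo (n + 1) Finset.univ
      (by rw [Finset.card_univ]; omega)
    rw [hF.finrank_logDer_univ, finrank_arHom_of_basis e b hb (by omega) (by omega),
      Finset.card_univ] at h1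
    simpa using h1
  · have h1 := finrank_logDer_lower A u v (n + 1) Finset.univ
    rw [hF.finrank_logDer_univ, finrank_arHom_of_basis e b hb (by omega) (by omega),
      Finset.card_univ] at h1
    simpa using h1


/-! ### The intersection lattice and its multiple points -/

theorem mem_zeroPlane {a w : Fin 3 → ℂ} : w ∈ zeroPlane a ↔ a ⬝ᵥ w = 0 := by
  rw [← eval_linForm]; rfl

/-- The linear functional with coefficient vector `a`. -/
def dotFunctional (a : Fin 3 → ℂ) : Module.Dual ℂ (Fin 3 → ℂ) := dotProductBilin ℂ ℂ a

theorem dotFunctional_apply (a w : Fin 3 → ℂ) : dotFunctional a w = a ⬝ᵥ w := rfl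

theorem zeroPlane_eq_ker (a : Fin 3 → ℂ) : zeroPlane a = LinearMap.ker (dotFunctional a) := by
  ext w
  rw [mem_zeroPlane, LinearMap.mem_ker, dotFunctional_apply]

theorem finrank_zeroPlane {a : Fin 3 → ℂ} (ha : a ≠ 0) : Module.finrank ℂ (zeroPlane a) = 2 := by
  have h0 : dotFunctional a ≠ 0 := by
    intro h
    refine ha (funext fun m => ?_)
    have := DFunLike.congr_fun h (Pi.single m 1)
    simpa [dotFunctional_apply] using this
  have := LinearMap.finrank_range_add_finrank_ker (dotFunctional a)
  rw [LinearMap.range_eq_top.2 (LinearMap.surjective h0), finrank_top, Module.finrank_self,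
    Module.finrank_fin_fun, ← zeroPlane_eq_ker] at this
  omega

/-- A functional vanishing on the kernel of another is a scalar multiple of it. -/
theorem mk_eq_of_zeroPlane_le {x y : Line} (h : zeroPlane x.rep ≤ zeroPlane y.rep) : x = y := by
  have h1 : dotFunctional y.rep ∈ Submodule.span ℂ (Set.range fun _ : Unit => dotFunctional x.rep) := by
    refine mem_span_of_iInf_ker_le_ker ?_
    rwa [iInf_const, ← zeroPlane_eq_ker, ← zeroPlane_eq_ker]
  rw [Set.range_const, Submodule.mem_span_singleton] at h1
  obtain ⟨c, hc⟩ := h1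
  have h2 : c • x.rep = y.rep := by
    funext m
    have := DFunLike.congr_fun hc (Pi.single m 1)
    simpa [dotFunctional_apply] using this
  rw [← x.mk_rep, ← y.mk_rep]
  exact ((Projectivization.mk_eq_mk_iff' ℂ _ _ y.rep_nonzero x.rep_nonzero).2 ⟨c, h2⟩).symm

variable {d : ℕ} {ℓ : Fin d → Line}

theorem zeroPlane_not_le (hℓ : ℓ ∈ XAll d) {i j : Fin d} (hij : i ≠ j) :
    ¬ zeroPlane (ℓ i).rep ≤ zeroPlane (ℓ j).rep := fun h => hij (hℓ (mk_eq_of_zeroPlane_le h))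

theorem finrank_zeroPlane_inf (hℓ : ℓ ∈ XAll d) {i j : Fin d} (hij : i ≠ j) :
    Module.finrank ℂ (zeroPlane (ℓ i).rep ⊓ zeroPlane (ℓ j).rep : Submodule ℂ (Fin 3 → ℂ)) = 1 := by
  have h := Submodule.finrank_sup_add_finrank_inf_eq (zeroPlane (ℓ i).rep) (zeroPlane (ℓ j).rep)
  have h1 : zeroPlane (ℓ i).rep < zeroPlane (ℓ i).rep ⊔ zeroPlane (ℓ j).rep :=
    lt_of_le_of_ne le_sup_left fun h => zeroPlane_not_le hℓ hij.symm (left_eq_sup.1 h)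
  have h2 := Submodule.finrank_lt_finrank_of_lt h1
  have h3 := Submodule.finrank_le (zeroPlane (ℓ i).rep ⊔ zeroPlane (ℓ j).rep)
  rw [Module.finrank_fin_fun] at h3
  rw [finrank_zeroPlane (ℓ i).rep_nonzero] at h2 h
  rw [finrank_zeroPlane (ℓ j).rep_nonzero] at h
  omega

/-- The plane over line j is not covered by its intersections with the finitely many other planes,
so v can be chosen off all of them. The presence of a second line forces v ≠ 0. -/
theorem exists_isFrame (hℓ : ℓ ∈ XAll d) (hd : 2 ≤ d) :
    ∃ u v, IsFrame (fun i => (ℓ i).rep) u v := by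
  have key : ∀ j, ∃ u v : Fin 3 → ℂ, (ℓ j).rep ⬝ᵥ u = 0 ∧ (ℓ j).rep ⬝ᵥ v = 0 ∧
      LinearIndependent ℂ ![u, v] ∧ ∀ i, i ≠ j → (ℓ i).rep ⬝ᵥ v ≠ 0 := by
    intro j
    obtain ⟨v, hv, hne⟩ := Module.Dual.exists_forall_mem_ne_zero_of_forall_exists
      (zeroPlane (ℓ j).rep) (fun i : {i // i ≠ j} => dotFunctional (ℓ i.1).rep) (by
        rintro ⟨i, hi⟩
        obtain ⟨x, hx, hx'⟩ := SetLike.not_le_iff_exists.1 (zeroPlane_not_le hℓ hi.symm)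
        exact ⟨x, hx, fun h => hx' (mem_zeroPlane.2 h)⟩)
    have : ∃ i : Fin d, i ≠ j := by
      have : Nontrivial (Fin d) := Fin.nontrivial_iff_two_le.2 hd
      exact exists_ne j
    obtain ⟨i, hi⟩ := this
    have hv0 : v ≠ 0 := fun h => hne ⟨i, hi⟩ (by rw [h, map_zero])
    have hnle : ¬ zeroPlane (ℓ j).rep ≤ Submodule.span ℂ {v} := by
      intro h
      have := Submodule.finrank_mono h
      rw [finrank_zeroPlane (ℓ j).rep_nonzero, finrank_span_singleton hv0] at this
      omega
    obtain ⟨u, hu, hu'⟩ := SetLike.not_le_iff_exists.1 hnle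
    refine ⟨u, v, mem_zeroPlane.1 hu, mem_zeroPlane.1 hv, ?_, fun i hi => hne ⟨i, hi⟩⟩
    refine linearIndependent_finCons.2 ⟨?_, ?_⟩
    · rw [linearIndependent_unique_iff]; simpa using hv0
    · simpa using hu'
  choose u v h1 h2 h3 h4 using key
  exact ⟨u, v, ⟨fun j => (ℓ j).rep_nonzero, h1, h2, h3, fun i j => h4 j i⟩⟩

/-- The subspace underlying an element of the intersection lattice. -/
abbrev InterLattice.space (x : InterLattice ℓ) : Submodule ℂ (Fin 3 → ℂ) := OrderDual.ofDual x.1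

theorem InterLattice.le_iff {x y : InterLattice ℓ} : x ≤ y ↔ y.space ≤ x.space := Iff.rfl

theorem InterLattice.lt_iff {x y : InterLattice ℓ} : x < y ↔ y.space < x.space := Iff.rfl

theorem InterLattice.space_injective : Function.Injective (InterLattice.space (ℓ := ℓ)) :=
  fun _ _ h => Subtype.ext h

/-- The intersection of the planes indexed by `s`. -/
def interOf (ℓ : Fin d → Line) (s : Set (Fin d)) : InterLattice ℓ :=
  ⟨OrderDual.toDual (⨅ i ∈ s, zeroPlane (ℓ i).rep), s, rfl⟩

theorem space_interOf (s : Set (Fin d)) :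
    (interOf ℓ s).space = ⨅ i ∈ s, zeroPlane (ℓ i).rep := rfl

theorem space_interOf_empty : (interOf ℓ ∅).space = ⊤ := by
  rw [space_interOf]; exact iInf_emptyset

theorem interOf_surjective : Function.Surjective (interOf ℓ) := by
  rintro ⟨W, s, hs⟩
  exact ⟨s, Subtype.ext hs.symm⟩

instance : Finite (InterLattice ℓ) := Finite.of_surjective _ (interOf_surjective (ℓ := ℓ))

/-- Codimension is strictly monotone, which bounds the height above. Intersecting with one more
plane lowers the dimension by at most one, so adding planes successively gives a long enough chain.
-/
theorem InterLattice.height_add_finrank (x : InterLattice ℓ) :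
    Order.height x + (Module.finrank ℂ x.space : ℕ∞) = 3 := by
  have hle : ∀ x : InterLattice ℓ, Module.finrank ℂ x.space ≤ 3 := fun x => by
    have := Submodule.finrank_le x.space
    rwa [Module.finrank_fin_fun] at this
  have hupper : Order.height x ≤ (3 - Module.finrank ℂ x.space : ℕ) := by
    have := Order.height_le_height_apply_of_strictMono
      (fun x : InterLattice ℓ => 3 - Module.finrank ℂ x.space) (fun y z hyz => by
        have := Submodule.finrank_lt_finrank_of_lt (InterLattice.lt_iff.1 hyz)
        have := hle y
        simp only
        omega) x
    simpa using this
  have hlower : ((3 - Module.finrank ℂ x.space : ℕ) : ℕ∞) ≤ Order.height x := by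
    have key : ∀ s : Finset (Fin d), ((3 - Module.finrank ℂ (interOf ℓ s).space : ℕ) : ℕ∞) ≤
        Order.height (interOf ℓ s) := by
      intro s
      induction s using Finset.induction_on with
      | empty => rw [Finset.coe_empty, space_interOf_empty, finrank_top]; simp
      | insert j s hj ih =>
        have hs : (interOf ℓ (insert j s : Finset (Fin d))).space =
            zeroPlane (ℓ j).rep ⊓ (interOf ℓ s).space := by
          simp only [space_interOf, Finset.coe_insert]
          exact iInf_insert
        by_cases heq : (interOf ℓ (insert j s : Finset (Fin d))).space = (interOf ℓ s).space
        · rwa [InterLattice.space_injective heq]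
        have hlt : interOf ℓ s < interOf ℓ (insert j s : Finset (Fin d)) :=
          InterLattice.lt_iff.2 (lt_of_le_of_ne (by rw [hs]; exact inf_le_right) heq)
        refine le_trans ?_ (Order.height_add_one_le hlt)
        refine le_trans ?_ (add_le_add_left ih 1)
        have h1 := Submodule.finrank_sup_add_finrank_inf_eq (zeroPlane (ℓ j).rep)
          (interOf ℓ s).space
        have h2 := Submodule.finrank_le (zeroPlane (ℓ j).rep ⊔ (interOf ℓ s).space)
        rw [Module.finrank_fin_fun] at h2
        rw [finrank_zeroPlane (ℓ j).rep_nonzero, ← hs] at h1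
        norm_cast
        omega
    obtain ⟨s, rfl⟩ := interOf_surjective x
    have := key s.toFinite.toFinset
    rwa [Set.Finite.coe_toFinset] at this
  rw [le_antisymm hupper hlower]
  have := hle x
  norm_cast
  omega

theorem InterLattice.height_eq_iff {x : InterLattice ℓ} {n m : ℕ} (hnm : n + m = 3) :
    Order.height x = n ↔ Module.finrank ℂ x.space = m := by
  have h := x.height_add_finrank
  constructor
  · intro hn
    rw [hn] at h
    norm_cast at h
    omega
  · intro hm
    rw [hm] at h
    have hfin : Order.height x ≠ ⊤ := fun ht => by rw [ht, top_add] at h; exact absurd h (by simp)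
    lift Order.height x to ℕ using hfin with r
    norm_cast at h ⊢
    omega

theorem space_interOf_singleton (i : Fin d) :
    (interOf ℓ {i}).space = zeroPlane (ℓ i).rep := by
  rw [space_interOf]; exact iInf_singleton

theorem space_interOf_pair (i j : Fin d) :
    (interOf ℓ {i, j}).space = zeroPlane (ℓ i).rep ⊓ zeroPlane (ℓ j).rep := by
  rw [space_interOf]; exact iInf_pair

open Classical in
/-- The lines through an element of the intersection lattice. -/
def linesThrough (p : InterLattice ℓ) : Finset (Fin d) :=
  Finset.univ.filter fun i => p.space ≤ zeroPlane (ℓ i).rep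

theorem mem_linesThrough {p : InterLattice ℓ} {i : Fin d} :
    i ∈ linesThrough p ↔ p.space ≤ zeroPlane (ℓ i).rep := by
  simp [linesThrough]

theorem InterLattice.exists_eq_interOf_singleton {a : InterLattice ℓ} (ha : Order.height a = 1) :
    ∃ i, a = interOf ℓ {i} := by
  have h2 : Module.finrank ℂ a.space = 2 := (InterLattice.height_eq_iff (n := 1) rfl).1 ha
  obtain ⟨s, rfl⟩ := interOf_surjective a
  rcases s.eq_empty_or_nonempty with rfl | ⟨i, hi⟩
  · rw [space_interOf_empty, finrank_top, Module.finrank_fin_fun] at h2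
    omega
  · refine ⟨i, InterLattice.space_injective ?_⟩
    rw [space_interOf_singleton]
    refine Submodule.eq_of_le_of_finrank_eq (iInf₂_le i hi) ?_
    rw [h2, finrank_zeroPlane (ℓ i).rep_nonzero]

theorem height_interOf_singleton (i : Fin d) : Order.height (interOf ℓ {i}) = 1 :=
  (InterLattice.height_eq_iff (n := 1) (m := 2) rfl).2 (by
    rw [space_interOf_singleton, finrank_zeroPlane (ℓ i).rep_nonzero])

theorem mult_eq_card_linesThrough (hℓ : ℓ ∈ XAll d) (p : InterLattice ℓ) :
    mult p = (linesThrough p).card := by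
  rw [mult, ← Set.ncard_coe_finset]
  symm
  refine Set.ncard_congr (fun i _ => interOf ℓ {i}) (fun i hi => ⟨height_interOf_singleton i, ?_⟩)
    (fun i j _ _ h => ?_) (fun a ha => ?_)
  · rw [InterLattice.le_iff, space_interOf_singleton]
    exact mem_linesThrough.1 hi
  · by_contra hij
    refine zeroPlane_not_le hℓ hij (le_of_eq ?_)
    rw [← space_interOf_singleton, ← space_interOf_singleton, h]
  · obtain ⟨i, rfl⟩ := InterLattice.exists_eq_interOf_singleton ha.1
    refine ⟨i, mem_linesThrough.2 ?_, rfl⟩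
    rw [← space_interOf_singleton]
    exact ha.2

theorem interOf_pair_mem (hℓ : ℓ ∈ XAll d) {i j : Fin d} (hij : i ≠ j) :
    interOf ℓ {i, j} ∈ multiplePoints (InterLattice ℓ) :=
  (InterLattice.height_eq_iff (n := 2) (m := 1) rfl).2 (by
    rw [space_interOf_pair, finrank_zeroPlane_inf hℓ hij])

theorem eq_interOf_pair (hℓ : ℓ ∈ XAll d) {i j : Fin d} (hij : i ≠ j) {p : InterLattice ℓ}
    (hp : p ∈ multiplePoints (InterLattice ℓ)) (hi : i ∈ linesThrough p) (hj : j ∈ linesThrough p) :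
    p = interOf ℓ {i, j} := by
  refine InterLattice.space_injective ?_
  rw [space_interOf_pair]
  refine Submodule.eq_of_le_of_finrank_eq
    (le_inf (mem_linesThrough.1 hi) (mem_linesThrough.1 hj)) ?_
  rw [finrank_zeroPlane_inf hℓ hij]
  exact (InterLattice.height_eq_iff (n := 2) (m := 1) rfl).1 hp

theorem left_mem_linesThrough_pair (i j : Fin d) : i ∈ linesThrough (interOf ℓ {i, j}) := by
  rw [mem_linesThrough, space_interOf_pair]; exact inf_le_left

theorem right_mem_linesThrough_pair (i j : Fin d) : j ∈ linesThrough (interOf ℓ {i, j}) := by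
  rw [mem_linesThrough, space_interOf_pair]; exact inf_le_right

/-- The restriction of form i is linear, so failure of coprimality means that its root is also a
root for form l. That root is the point where lines i and j meet. -/
theorem mem_linesThrough_pair_of_not_isCoprime (hℓ : ℓ ∈ XAll d) {u v : Fin d → Fin 3 → ℂ}
    (hF : IsFrame (fun i => (ℓ i).rep) u v) {i l j : Fin d} (hi : i ≠ j)
    (h : ¬ IsCoprime (res (u j) (v j) (linForm (ℓ i).rep)) (res (u j) (v j) (linForm (ℓ l).rep))) :
    l ∈ linesThrough (interOf ℓ {i, j}) := by
  rw [mem_linesThrough, space_interOf_pair]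
  rw [(hF.irreducible_res hi).coprime_iff_not_dvd, not_not] at h
  have hv := hF.dot_ne_zero i j hi
  set t : ℂ := - ((ℓ i).rep ⬝ᵥ u j) / ((ℓ i).rep ⬝ᵥ v j) with ht
  set w := u j + t • v j with hw
  have hwi : (ℓ i).rep ⬝ᵥ w = 0 := by
    rw [hw, dotProduct_add, dotProduct_smul, ht, smul_eq_mul]
    field_simp
    ring
  have hwl : (ℓ l).rep ⬝ᵥ w = 0 := by
    obtain ⟨q, hq⟩ := h
    rw [← eval_linForm, hw, ← eval_res, hq, Polynomial.eval_mul, eval_res, ← hw, eval_linForm,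
      hwi, zero_mul]
  have hwj : (ℓ j).rep ⬝ᵥ w = 0 := by
    rw [hw, dotProduct_add, dotProduct_smul, hF.dot_left, hF.dot_right]
    simp
  have hw0 : w ≠ 0 := by
    intro h0
    have := LinearIndependent.pair_iff.1 (hF.linearIndependent j) 1 t (by rw [one_smul, ← hw, h0])
    exact one_ne_zero this.1
  have hspan : Submodule.span ℂ {w} = zeroPlane (ℓ i).rep ⊓ zeroPlane (ℓ j).rep := by
    refine Submodule.eq_of_le_of_finrank_eq ?_ ?_
    · rw [Submodule.span_singleton_le_iff_mem]
      exact ⟨mem_zeroPlane.2 hwi, mem_zeroPlane.2 hwj⟩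
    · rw [finrank_span_singleton hw0, finrank_zeroPlane_inf hℓ hi]
  rw [← hspan, Submodule.span_singleton_le_iff_mem]
  exact mem_zeroPlane.2 hwl

instance : Fintype (multiplePoints (InterLattice ℓ)) := Fintype.ofFinite _

/-! ### Counting over multiple points -/

/-- Ordered pairs of distinct lines are partitioned by their intersection points. -/
theorem sum_card_mul_card_sub_one (hℓ : ℓ ∈ XAll d) :
    ∑ p : multiplePoints (InterLattice ℓ),
      ((linesThrough p.1).card : ℤ) * ((linesThrough p.1).card - 1) = d * (d - 1) := by
  classical
  have hoff : ∀ s : Finset (Fin d), ((s.offDiag.card : ℕ) : ℤ) = s.card * (s.card - 1) := by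
    intro s
    rw [Finset.offDiag_card, Nat.cast_sub (Nat.le_mul_self _)]
    push_cast; ring
  have h : (Finset.univ.biUnion fun p : multiplePoints (InterLattice ℓ) =>
      (linesThrough p.1).offDiag) = (Finset.univ : Finset (Fin d)).offDiag := by
    ext ⟨i, j⟩
    simp only [Finset.mem_biUnion, Finset.mem_univ, true_and, Finset.mem_offDiag]
    constructor
    · rintro ⟨p, -, -, hij⟩; exact hij
    · intro hij
      exact ⟨⟨_, interOf_pair_mem hℓ hij⟩, left_mem_linesThrough_pair i j,
        right_mem_linesThrough_pair i j, hij⟩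
  have hcard := congrArg (fun s => ((Finset.card s : ℕ) : ℤ)) h
  rw [Finset.card_biUnion, hoff, Finset.card_univ, Fintype.card_fin, Nat.cast_sum] at hcard
  · rw [← hcard]
    exact Finset.sum_congr rfl fun p _ => (hoff _).symm
  · intro p _ q _ hpq
    refine Finset.disjoint_left.2 ?_
    rintro ⟨i, j⟩ hp hq
    rw [Finset.mem_offDiag] at hp hq
    refine hpq (Subtype.ext ?_)
    rw [eq_interOf_pair hℓ hp.2.2 p.2 hp.1 hp.2.1, eq_interOf_pair hℓ hp.2.2 q.2 hq.1 hq.2.1]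

/-- Multiple points and multiplicities are defined by heights and the order alone, so an order
isomorphism preserves them. -/
theorem finsum_multiplePoints {L : Type*} [PartialOrder L] (hℓ : ℓ ∈ XAll d)
    (e : InterLattice ℓ ≃o L) (g : ℕ → ℤ) :
    ∑ᶠ p ∈ multiplePoints L, g (mult p) =
      ∑ p : multiplePoints (InterLattice ℓ), g (linesThrough p.1).card := by
  have hbij : Set.BijOn e (multiplePoints (InterLattice ℓ)) (multiplePoints L) := by
    refine ⟨fun p hp => ?_, e.injective.injOn, fun q hq => ⟨e.symm q, ?_, by simp⟩⟩
    · exact (Order.height_orderIso e p).trans hp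
    · exact (Order.height_orderIso e.symm q).trans hq
  rw [← finsum_mem_eq_of_bijOn (f := fun p => g (linesThrough p).card) e hbij,
    ← finsum_set_coe_eq_finsum_mem, finsum_eq_sum_of_fintype]
  intro p _
  rw [← mult_eq_card_linesThrough hℓ, mult, mult]
  congr 1
  refine Set.ncard_congr (fun a _ => e a) (fun a ha => ⟨?_, ?_⟩) (fun a b _ _ h => e.injective h)
    (fun b hb => ⟨e.symm b, ⟨?_, ?_⟩, by simp⟩)
  · exact (Order.height_orderIso e a).trans ha.1
  · exact e.monotone ha.2
  · exact (Order.height_orderIso e.symm b).trans hb.1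
  · exact e.symm_apply_le.2 hb.2

theorem tau_add_sumMult {L : Type*} [PartialOrder L] (hℓ : ℓ ∈ XAll d)
    (e : InterLattice ℓ ≃o L) : tau L + sumMult L = d * (d - 1) := by
  rw [tau, sumMult, finsum_multiplePoints hℓ e fun m => ((m : ℤ) - 1) ^ 2,
    finsum_multiplePoints hℓ e fun m => (m : ℤ) - 1, ← Finset.sum_add_distrib,
    ← sum_card_mul_card_sub_one hℓ]
  exact Finset.sum_congr rfl fun p _ => by ring

theorem four_mul_sumMult_le {L : Type*} [PartialOrder L] (hd : 2 ≤ d) (hℓ : ℓ ∈ FX d)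
    (e : InterLattice ℓ ≃o L) : 4 * sumMult L ≤ (d - 1) * (d + 3) := by
  obtain ⟨hX, hfree⟩ := hℓ
  obtain ⟨u, v, hF⟩ := exists_isFrame hX hd
  have : Nonempty (Fin d) := ⟨⟨0, by omega⟩⟩
  have h := hF.four_mul_le_of_isFreeCurve
    (fun p : multiplePoints (InterLattice ℓ) => linesThrough p.1)
    (fun i j hij => ⟨⟨_, interOf_pair_mem hX hij⟩, left_mem_linesThrough_pair i j,
      right_mem_linesThrough_pair i j⟩)
    (fun i j p q hij hip hjp hiq hjq => Subtype.ext
      ((eq_interOf_pair hX hij p.2 hip hjp).trans (eq_interOf_pair hX hij q.2 hiq hjq).symm))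
    (fun i l j hi _ hcop => ⟨⟨_, interOf_pair_mem hX hi⟩, left_mem_linesThrough_pair i j,
      mem_linesThrough_pair_of_not_isCoprime hX hF hi hcop, right_mem_linesThrough_pair i j⟩)
    hfree
  rw [Fintype.card_fin] at h
  refine le_trans (mul_le_mul_of_nonneg_left ?_ (by norm_num)) h
  rw [sumMult, finsum_multiplePoints hX e fun m => (m : ℤ) - 1, Nat.cast_sum]
  exact Finset.sum_le_sum fun p _ => by omega

end LineArr

end

theorem proposition6p5 (d : ℕ) (hd : 4 ≤ d) (L : Type*) [PartialOrder L]
    (hL : LineArr.IsLatticeOfLines d L) :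
    ((LineArr.tau L : ℝ) < 3 / 4 * ((d : ℝ) - 1) ^ 2 →
      LineArr.FX d ∩ LineArr.XOf d L = ∅) ∧
    (((d : ℝ) + 3) * ((d : ℝ) - 1) / 4 < (LineArr.sumMult L : ℝ) →
      (LineArr.tau L : ℝ) < 3 / 4 * ((d : ℝ) - 1) ^ 2) := by
  obtain ⟨ℓ, hℓ, ⟨e⟩⟩ := hL
  -- This identity makes (∗) equivalent to the lower bound on Σ(m_p-1) in (2), since d(d-1) -
  -- ¾(d-1)² = (d+3)(d-1)/4.
  have hsum : (LineArr.tau L : ℝ) + LineArr.sumMult L = d * (d - 1) := by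
    exact_mod_cast LineArr.tau_add_sumMult hℓ e
  refine ⟨fun hτ => Set.eq_empty_iff_forall_notMem.2 ?_, fun h => by nlinarith⟩
  rintro ℓ' ⟨hfree, -, ⟨e'⟩⟩
  have h : 4 * (LineArr.sumMult L : ℝ) ≤ (d - 1) * (d + 3) := by
    exact_mod_cast LineArr.four_mul_sumMult_le (by omega) hfree e'
  nlinarith
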